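/- Let $G$ be a finite simple graph with symmetric arc set $A$; $o(e),t(e),\bar e$ denote origin, terminus and inverse of an arc. A rotation system $(G,\rho,\tau)$ consists of a cyclic permutation $\rho_x$ of $A_x=\{e : t(e)=x\}$ for each vertex $x$ (with union $\rho$) and a twist $\tau:A\to\mathbb Z_2$ with $\tau(e)=\tau(\bar e)$. Switching a vertex $x$ replaces $\rho_x$ by $\rho_x^{-1}$ and changes $\tau$ on all edges incident to $x$; two rotation systems are equivalent if one arises from the other by finitely many switches. The double cover $G^\tau$ has vertices $(x,k)$, $k\in\mathbb Z_2$, with $(x,j)\sim(y,k)$ iff $x\sim y$ and $k=j+\tau((x,y))$, and the rotation $\tilde\rho=\rho\oplus\rho^{-1}$ ($\rho$ on sheet $0$, $\rho^{-1}$ on sheet $1$). Its faces are the orbits of $e\mapsto\overline{\tilde\rho(e)}$ on the arcs of $G^\tau$. The vertices of its blow-up graph are the arcs $e$ of $G^\tau$, and its arcs are the island arcs $(e,\tilde\rho(e))$ and the bridge arcs $(e,\bar e)$, where a bridge arc has the twist of the underlying edge of $G$. Given a set $\delta A_{is}$ of island arcs, each $\xi\in\delta A_{is}$ is subdivided into $\xi^-,\xi^+$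 and a semi-infinite path (tail) is attached at the new vertex; $\delta X\cong\delta A_{is}$ is the set of new vertices, and $\tilde G$ is the resulting graph. Let $C=\begin{bmatrix}a&b\\c&d\end{bmatrix}$ be unitary. The quantum walk on $\mathbb C^{\tilde A}$, where $\tilde A$ is the arc set of $\tilde G$, is free along the tails, and at every other vertex, and at the root of every tail, it acts by \[\begin{bmatrix}\Psi_{t+1}(\text{outgoing island arc})\\ \Psi_{t+1}(\text{outgoing bridge or tail arc }e)\end{bmatrix}=\begin{bmatrix}1&0\\0&(-1)^{\tau(e)}\end{bmatrix}C\begin{bmatrix}\Psi_t(\text{incoming island arc})\\ \Psi_t(\text{incoming bridge or tail arc})\end{bmatrix},\] where $\tau=0$ on tails. The initial state is a constant $\alpha_x$ on the inward arcs of the tail at $x$, for each $x\in\delta X$, and zero elsewhere. The scattering matrix $S$ on $\mathbb C^{\delta X}$ is defined by: for every $\alpha$, the walk converges on every arc to a stationary state whose values $\beta_{out}(x)$ and $\alpha_{in}(x)$ on the tail arcs leaving and entering $x\in\delta X$ satisfy $\beta_{out}=S\alpha_{in}$. Let $(G,\rho_1,\tau_1)$ and $(G,\rho_2,\tau_2)$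 be equivalent through a given sequence of switches in which the vertex $x$ is switched $s(x)$ times, and let $\phi$ be the isomorphism of their double covers which is $(x,k)\mapsto(x,k+s(x))$ on vertices. Choose boundary sets of island arcs of the two systems that correspond to each other under $\phi$, and let $\tilde G_1$ be the graph with tails of the first system. On the arcs of $\tilde G_1$, let $\theta_i$ be $\pi$ on the bridges over edges with $\tau_i=1$ and $0$ on all other arcs. Fix one base vertex in each connected component of $\tilde G_1$, and let $\Delta(v)=\int_p(\theta_2-\theta_1)$ for a path $p$ from the base vertex of the component of $v$ to $v$ (for any choice of such paths, which always exist). Then both systems have a unique scattering matrix, $S_1$ and $S_2$ respectively, and, after the identification of the two boundary sets by $\phi$, \[S_2=D^*S_1D,\] where $D=\bigoplus_f D_f$, over the faces $f$ of the double cover of the first system, is the diagonal unitary matrix whose block for $f=(e_0,\dots,e_{\kappa-1})$ is \[D_f=\mathrm{diag}\bigl[e^{-i\Delta(t(e_0))},\dots,e^{-i\Delta(t(e_{\kappa-1}))}\bigr].\] Here $e_j$ is regarded as a bridge arc and labels the boundary vertex on the island arc that starts at its terminal vertex $t(e_j)$; only those $e_j$ for which this island arc belongs to the chosen boundary set occur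 (all of them if every island arc carries a tail). -/

import Mathlib

open scoped Matrix

/-- A rotation system on a simple graph `G`: a cyclic permutation `rot x` of the set `A_x` of the
arcs with terminal vertex `x`, for every vertex `x`, and a twist `A → ℤ/2` with
`twist e = twist ē`. -/
structure RotationSystem {V : Type*} (G : SimpleGraph V) where
  rot : ∀ x : V, Equiv.Perm {e : G.Dart // e.snd = x}
  rot_cyclic : ∀ x : V, (rot x).IsCycleOn Set.univ
  twist : G.Dart → ZMod 2
  twist_symm : ∀ e : G.Dart, twist e.symm = twist e

/-- The arcs of the double covering graph `G^τ`, whose vertices are the pairs `(x, k)` with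
`k : ZMod 2` (the sheet), `(x, j)` and `(y, k)` being adjacent iff `x`, `y` are adjacent in `G` and
`k = j + τ (x, y)`. The arc of `G^τ` above `e : x → y` with terminal vertex `(y, k)` is
`(e, k)`; its origin is `(x, k + τ e)`. -/
abbrev CoverArc {V : Type*} (G : SimpleGraph V) : Type _ := G.Dart × ZMod 2

/-- The vertices of the blow-up graph with tails. Blow-up vertices are the arcs of `G^τ`;
`tail ξ n` is the `n`-th vertex of the semi-infinite path attached to the boundary island arc `ξ`,
and `tail ξ 0` is its root, a vertex of `δX`. Here `B` is the set `δA_is` of boundary island arcs,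
the island arc `(e, ρ e)` of the blow-up of `G^τ` being labelled by its origin `e`. -/
inductive TailedVertex {V : Type*} {G : SimpleGraph V} (B : Finset (CoverArc G)) : Type _
  | inner (e : CoverArc G)
  | tail (ξ : B) (n : ℕ)

/-- The arcs of the blow-up graph with tails:
* `island e`: the island arc `(e, ρ e)`, when it is not a boundary arc;
* `quayIn ξ`, `quayOut ξ`: the two halves `ξ⁻`, `ξ⁺` of a boundary island arc `ξ`;
* `bridge e`: the bridge arc `(e, ē)`;
* `tailIn ξ n`: the tail arc from the `(n + 1)`-st to the `n`-th tail vertex (`n = 0`: pier);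
* `tailOut ξ n`: its inverse. -/
inductive TailedArc {V : Type*} {G : SimpleGraph V} (B : Finset (CoverArc G)) : Type _
  | island (e : CoverArc G) (he : e ∉ B)
  | quayIn (ξ : B)
  | quayOut (ξ : B)
  | bridge (e : CoverArc G)
  | tailIn (ξ : B) (n : ℕ)
  | tailOut (ξ : B) (n : ℕ)

/-- The integral of a function `θ` on arcs along a sequence of arcs. -/
def pathIntegral {A : Type*} (θ : A → ℝ) (p : List A) : ℝ := (p.map θ).sum

/-- The bijection `φ` between the arcs of the double covering graphs of a rotation system and of
the one obtained from it by switching the vertices in the list `l`, one after the other: every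
switch at `x` exchanges the sheets of `(x, 0)` and `(x, 1)` and leaves all other vertices alone, so
that `(x, k)` goes to `(x, k + s x)`, where `s x` is the number of switches at `x`. -/
def sheetShift {V : Type*} [DecidableEq V] (G : SimpleGraph V) (l : List V) :
    Equiv.Perm (CoverArc G) where
  toFun e := (e.1, e.2 + (l.count e.1.snd : ZMod 2))
  invFun e := (e.1, e.2 - (l.count e.1.snd : ZMod 2))
  left_inv e := by simp
  right_inv e := by simp

namespace RotationSystem

variable {V : Type*} {G : SimpleGraph V}

/-- Switching at the vertex `x`: reverse the rotation at `x` and change the types of all edges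
incident to `x`. -/
def switch [DecidableEq V] (R : RotationSystem G) (x : V) : RotationSystem G where
  rot := Function.update R.rot x (R.rot x)⁻¹
  rot_cyclic y := by
    by_cases h : y = x
    · subst h
      simpa using (R.rot_cyclic y).inv
    · simpa [Function.update_of_ne h] using R.rot_cyclic y
  twist e := R.twist e + if e.fst = x ∨ e.snd = x then 1 else 0
  twist_symm e := by
    simp only [R.twist_symm, SimpleGraph.Dart.symm_toProd, Prod.fst_swap, Prod.snd_swap, or_comm]

/-- `R₂` arises from `R₁` by switching at the vertices of the list `l`, one after the other. Two
rotation systems of `G` are equivalent iff this holds for some list `l`. -/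
def EquivalentVia [DecidableEq V] (R₁ : RotationSystem G) (l : List V) (R₂ : RotationSystem G) :
    Prop :=
  R₂ = l.foldl switch R₁

/-- The rotation `ρ` on the set of all arcs of `G`, the union of the rotations at the vertices. -/
def rho (R : RotationSystem G) : Equiv.Perm G.Dart :=
  (Equiv.sigmaFiberEquiv fun e : G.Dart => e.snd).permCongr (Equiv.sigmaCongrRight R.rot)

/-- The rotation `ρ ⊕ ρ⁻¹` of the double covering graph: `ρ` on the sheet `0` and `ρ⁻¹` on the
sheet `1`. -/
def coverRot (R : RotationSystem G) : Equiv.Perm (CoverArc G) :=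
  Equiv.prodCongrLeft fun k : ZMod 2 => if k = 0 then R.rho else R.rho⁻¹

/-- The inversion `e ↦ ē` of the arcs of the double covering graph. -/
def coverBar (R : RotationSystem G) : Equiv.Perm (CoverArc G) :=
  Function.Involutive.toPerm (fun e => (e.1.symm, e.2 + R.twist e.1)) fun e => by
    simp [R.twist_symm, add_assoc, CharTwo.add_self_eq_zero]

/-- The step `e ↦ σ (ρ e)` along the facial walks of the double covering rotation system, which has
no twists. -/
def facePerm (R : RotationSystem G) : Equiv.Perm (CoverArc G) := R.coverRot.trans R.coverBar

/-- The faces of the double covering rotation system: its facial walks up to cyclic shifts. -/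
def Face (R : RotationSystem G) : Type _ := Quotient (Equiv.Perm.SameCycle.setoid R.facePerm)

/-- The face whose facial walk runs through `e`. -/
def faceOf (R : RotationSystem G) (e : CoverArc G) : R.Face := Quotient.mk _ e

variable {B : Finset (CoverArc G)}

/-- The origin of an arc of the blow-up graph with tails. -/
def origin (_R : RotationSystem G) : TailedArc B → TailedVertex B
  | .island e _ => .inner e
  | .quayIn ξ => .inner ξ
  | .quayOut ξ => .tail ξ 0
  | .bridge e => .inner e
  | .tailIn ξ n => .tail ξ (n + 1)
  | .tailOut ξ n => .tail ξ n

/-- The terminal vertex of an arc of the blow-up graph with tails. -/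
def terminus (R : RotationSystem G) : TailedArc B → TailedVertex B
  | .island e _ => .inner (R.coverRot e)
  | .quayIn ξ => .tail ξ 0
  | .quayOut ξ => .inner (R.coverRot ξ)
  | .bridge e => .inner (R.coverBar e)
  | .tailIn ξ n => .tail ξ n
  | .tailOut ξ n => .tail ξ (n + 1)

/-- The bridge arc with terminal vertex `e`, for a blow-up vertex `e`. It is `br ξ` for the island
arc `ξ = (e, ρ e)`. -/
def bridgeTo (R : RotationSystem G) (e : CoverArc G) : TailedArc B := .bridge (R.coverBar e)

open Classical in
/-- The island arc (possibly a quay `η⁺`) with terminal vertex `e`, for a blow-up vertex `e`. -/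
noncomputable def islandTo (R : RotationSystem G) (e : CoverArc G) : TailedArc B :=
  if h : R.coverRot.symm e ∈ B then .quayOut ⟨R.coverRot.symm e, h⟩
  else .island (R.coverRot.symm e) h

/-- The time evolution operator of the quantum walk on the blow-up graph with tails, with the local
coin `C = [a, b; c, d]`, the sign `(-1)^τ` on the bridges and the free evolution on the tails. -/
noncomputable def evolve (R : RotationSystem G) (C : Matrix (Fin 2) (Fin 2) ℂ)
    (Ψ : TailedArc B → ℂ) : TailedArc B → ℂ
  | .island e _ => C 0 0 * Ψ (R.islandTo e) + C 0 1 * Ψ (R.bridgeTo e)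
  | .quayIn ξ => C 0 0 * Ψ (R.islandTo ξ) + C 0 1 * Ψ (R.bridgeTo ξ)
  | .quayOut ξ => C 0 0 * Ψ (.quayIn ξ) + C 0 1 * Ψ (.tailIn ξ 0)
  | .bridge e =>
      (-1) ^ (R.twist e.1).val * (C 1 0 * Ψ (R.islandTo e) + C 1 1 * Ψ (R.bridgeTo e))
  | .tailOut ξ 0 => C 1 0 * Ψ (.quayIn ξ) + C 1 1 * Ψ (.tailIn ξ 0)
  | .tailOut ξ (n + 1) => Ψ (.tailOut ξ n)
  | .tailIn ξ n => Ψ (.tailIn ξ (n + 1))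

/-- The initial state: the constant `α ξ` on the arcs of the tail at `ξ` which point towards the
interior, and zero on all other arcs. -/
def initialState (α : B → ℂ) : TailedArc B → ℂ
  | .tailIn ξ _ => α ξ
  | _ => 0

/-- `S` is the scattering matrix: for every inflow the walk converges arcwise to a stationary
state `Ψ∞`, whose outflow `β_out` and inflow `α_in` on the piers satisfy `β_out = S α_in`. -/
def IsScatteringMatrix (R : RotationSystem G) (C : Matrix (Fin 2) (Fin 2) ℂ)
    (S : Matrix B B ℂ) : Prop :=
  ∀ α : B → ℂ, ∃ Ψinf : TailedArc B → ℂ,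
    (∀ a, Filter.Tendsto (fun t : ℕ => (R.evolve C)^[t] (initialState α) a) Filter.atTop
      (nhds (Ψinf a))) ∧
    (fun ξ : B => Ψinf (.tailOut ξ 0)) = S *ᵥ fun ξ : B => Ψinf (.tailIn ξ 0)

/-- `R.IsPath u p v`: the sequence `p` of arcs of the blow-up graph with tails is a path from `u`
to `v`. -/
def IsPath (R : RotationSystem G) : TailedVertex B → List (TailedArc B) → TailedVertex B → Prop
  | u, [], v => u = v
  | u, a :: p, v => R.origin a = u ∧ R.IsPath (R.terminus a) p v

/-- The function `θ` on arcs which is `π` on the bridges with twist `1` and `0` on all other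
arcs. -/
noncomputable def theta (R : RotationSystem G) : TailedArc B → ℝ
  | .bridge e => if R.twist e.1 = 1 then Real.pi else 0
  | _ => 0

/-- `Δ` is a gauge phase from `R₁` to `R₂`: after fixing one base vertex in every connected
component of the blow-up graph with tails of `R₁` (`base v` is the one in the component of `v`), the
number `Δ v` is the integral of `θ₂ - θ₁` along a path from the base vertex to `v`. -/
def IsGaugePhase (R₁ R₂ : RotationSystem G) (Δ : TailedVertex B → ℝ) : Prop :=
  ∃ base : TailedVertex B → TailedVertex B,
    (∀ u p v, R₁.IsPath u p v → base u = base v) ∧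
    ∀ v, ∃ p, R₁.IsPath (base v) p v ∧
      Δ v = pathIntegral (fun a => R₂.theta a - R₁.theta a) p

open Classical in
/-- The block `D_f` of a face `f`: the diagonal matrix with the entries `e^{-iΔ(t(e))}`, where `e`
runs through the bridges of the facial walk `f` which are followed by a boundary island arc `ξ`,
that is `e = br ξ`. -/
noncomputable def gaugeBlock (R : RotationSystem G) (Δ : TailedVertex B → ℝ) (f : R.Face) :
    Matrix {ξ : B // R.faceOf ξ = f} {ξ : B // R.faceOf ξ = f} ℂ :=
  Matrix.diagonal fun ξ =>
    Complex.exp (-(Complex.I * (Δ (R.terminus (R.bridgeTo (ξ : B))) : ℂ)))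

open Classical in
/-- The matrix `D = ⊕_f D_f`, the direct sum over all faces. -/
noncomputable def gaugeMatrix (R : RotationSystem G) (Δ : TailedVertex B → ℝ) : Matrix B B ℂ :=
  Matrix.reindex (Equiv.sigmaFiberEquiv fun ξ : B => R.faceOf ξ)
    (Equiv.sigmaFiberEquiv fun ξ : B => R.faceOf ξ)
    (Matrix.blockDiagonal' (R.gaugeBlock Δ))

end RotationSystem

/-! Existence of the scattering matrices. With constant inflow, the state on the finitely many
interior arcs and inward piers is a partial sum of the Neumann series `∑ T ^ k a`, where `a` is the
inflow and `T` the walk with the tails cut off. Unitarity of the coin makes `T` a contraction, and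
`a` is orthogonal to the range of `T`, since no interior amplitude reaches an inward pier. The
vectors whose norm all powers of `T` preserve form a subspace `K` that `T` maps onto itself and
whose orthogonal complement is also invariant. On that complement the powers of `T` tend to zero and
`1 - T` is invertible; as `a` lies in it, the series converges (`exists_tendsto_sum_pow_apply`).

Comparison. Let `s` count the switches mod 2. Switching conjugates the rotation and the inversion of
the double cover by `sheetShift` and changes the twist by the coboundary `s(o(e)) + s(t(e))`
(`EquivalentVia.twist_eq`). Hence `θ₂ - θ₁` has trivial holonomy mod `2π`, and `exp (-iΔ)` is a sign
`(-1)^κ` with `κ + s` constant on components (`EquivalentVia.exp_gaugePhase`). Multiplying the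
amplitude on each arc by the sign at its terminus turns the first walk into the second
(`EquivalentVia.evolve_shiftArc`): both inputs of a coin carry the same sign, `κ` is constant along
islands and tails, and its jump across a bridge is the change of twist. Comparing inflow and outflow
gives the formula for the scattering matrices. -/

/-! ### Contractions of a finite-dimensional Hilbert space -/

section Contraction

variable {X : Type*} [NormedAddCommGroup X] [InnerProductSpace ℂ X]

/-- A contraction does not increase the norm under iteration. -/
theorem antitone_norm_pow_apply (T : X →L[ℂ] X) (hT : ∀ x, ‖T x‖ ≤ ‖x‖) (x : X) :
    Antitone fun n : ℕ => ‖(T ^ n) x‖ := by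
  refine antitone_nat_of_succ_le fun n => ?_
  rw [pow_succ']
  exact hT _

variable [FiniteDimensional ℂ X]

theorem adjoint_apply_apply_eq_self (T : X →L[ℂ] X) (hT : ∀ x, ‖T x‖ ≤ ‖x‖) {w : X}
    (hw : ‖T w‖ = ‖w‖) : haveI := FiniteDimensional.complete ℂ X; T.adjoint (T w) = w := by
  have := FiniteDimensional.complete ℂ X
  have hadj : ‖T.adjoint (T w)‖ ≤ ‖T w‖ := by
    have h1 : ‖T.adjoint‖ ≤ 1 := by
      rw [LinearIsometryEquiv.norm_map]
      exact T.opNorm_le_bound zero_le_one fun x => by simpa using hT x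
    simpa using T.adjoint.le_of_opNorm_le h1 (T w)
  -- The square expands to `‖T* T w‖² - 2 ‖T w‖² + ‖w‖²`, and neither outer term exceeds `‖T w‖²`.
  have hsq : ‖T.adjoint (T w) - w‖ ^ 2 ≤ 0 := by
    rw [@norm_sub_sq ℂ, ContinuousLinearMap.adjoint_inner_left, inner_self_eq_norm_sq]
    have := norm_nonneg (T.adjoint (T w))
    rw [hw] at *
    nlinarith
  have : ‖T.adjoint (T w) - w‖ = 0 := by nlinarith [norm_nonneg (T.adjoint (T w) - w)]
  exact sub_eq_zero.1 (norm_eq_zero.1 this)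

/-- The space of the vectors whose norm is preserved by all powers of a contraction. -/
noncomputable def isometricPart (T : X →L[ℂ] X) : Submodule ℂ X :=
  haveI := FiniteDimensional.complete ℂ X
  ⨅ n : ℕ, (LinearMap.ker ((T ^ n).adjoint * T ^ n - 1 : X →L[ℂ] X).toLinearMap)

theorem mem_isometricPart (T : X →L[ℂ] X) (hT : ∀ x, ‖T x‖ ≤ ‖x‖) {x : X} :
    x ∈ isometricPart T ↔ ∀ n : ℕ, ‖(T ^ n) x‖ = ‖x‖ := by
  have := FiniteDimensional.complete ℂ X
  simp only [isometricPart, Submodule.mem_iInf, LinearMap.mem_ker]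
  refine forall_congr' fun n => ⟨fun h => ?_, fun h => ?_⟩
  · have h' : (T ^ n).adjoint ((T ^ n) x) = x := sub_eq_zero.1 h
    have h2 : ‖(T ^ n) x‖ ^ 2 = ‖x‖ ^ 2 := by
      have := @inner_self_eq_norm_sq ℂ X _ _ _ ((T ^ n) x)
      rw [← ContinuousLinearMap.adjoint_inner_left, h', inner_self_eq_norm_sq] at this
      exact this.symm
    exact (sq_eq_sq₀ (norm_nonneg _) (norm_nonneg _)).1 h2
  · refine sub_eq_zero.2 (adjoint_apply_apply_eq_self (T ^ n) (fun y => ?_) h)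
    simpa using antitone_norm_pow_apply T hT y n.zero_le

theorem map_mem_isometricPart (T : X →L[ℂ] X) (hT : ∀ x, ‖T x‖ ≤ ‖x‖) {x : X}
    (hx : x ∈ isometricPart T) : T x ∈ isometricPart T := by
  rw [mem_isometricPart T hT] at *
  intro n
  have h1 := hx (n + 1)
  have h2 := hx 1
  rw [pow_succ] at h1
  rw [pow_one] at h2
  rw [h2]
  exact h1

/-- `T` preserves norms on the isometric part, so it is injective there, and by finite dimension
surjective. -/
theorem exists_map_eq_of_mem_isometricPart (T : X →L[ℂ] X) (hT : ∀ x, ‖T x‖ ≤ ‖x‖) {x : X}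
    (hx : x ∈ isometricPart T) : ∃ w ∈ isometricPart T, T w = x := by
  let f := T.toLinearMap.restrict (p := isometricPart T) (q := isometricPart T)
    fun x hx => map_mem_isometricPart T hT hx
  have hf : Function.Injective f := by
    rw [← LinearMap.ker_eq_bot, LinearMap.ker_eq_bot']
    intro m hm
    have h1 : T m = 0 := congrArg Subtype.val hm
    have h2 := (mem_isometricPart T hT).1 m.2 1
    rw [pow_one, h1, norm_zero] at h2
    exact Subtype.ext (norm_eq_zero.1 h2.symm)
  obtain ⟨w, hw⟩ := LinearMap.injective_iff_surjective.1 hf ⟨x, hx⟩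
  exact ⟨w, w.2, congrArg Subtype.val hw⟩

/-- Any `v` in the isometric part is `T w` with `w` in it and `T* T w = w`, so `⟪v, T x⟫ = ⟪w, x⟫ =
0`. -/
theorem map_mem_isometricPart_orthogonal (T : X →L[ℂ] X) (hT : ∀ x, ‖T x‖ ≤ ‖x‖) {x : X}
    (hx : x ∈ (isometricPart T)ᗮ) : T x ∈ (isometricPart T)ᗮ := by
  have := FiniteDimensional.complete ℂ X
  rw [Submodule.mem_orthogonal] at *
  intro v hv
  obtain ⟨w, hw, rfl⟩ := exists_map_eq_of_mem_isometricPart T hT hv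
  have hn : ‖T w‖ = ‖w‖ := by simpa using (mem_isometricPart T hT).1 hw 1
  rw [← ContinuousLinearMap.adjoint_inner_left, adjoint_apply_apply_eq_self T hT hn]
  exact hx w hw

/-- By compactness the orbit has a limit point `z`. The decreasing norms force `‖T ^ k z‖` to be
independent of `k`, so `z` lies both in the isometric part and in its complement and vanishes. -/
theorem tendsto_pow_apply_of_mem_orthogonal (T : X →L[ℂ] X) (hT : ∀ x, ‖T x‖ ≤ ‖x‖) {y : X}
    (hy : y ∈ (isometricPart T)ᗮ) :
    Filter.Tendsto (fun n : ℕ => (T ^ n) y) Filter.atTop (nhds 0) := by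
  have := FiniteDimensional.complete ℂ X
  have : ProperSpace X := FiniteDimensional.proper ℂ X
  have hanti := antitone_norm_pow_apply T hT y
  have hlim := tendsto_atTop_ciInf hanti ⟨0, by rintro _ ⟨n, rfl⟩; exact norm_nonneg _⟩
  set L := ⨅ n : ℕ, ‖(T ^ n) y‖
  have hmem : ∀ n : ℕ, (T ^ n) y ∈ (isometricPart T)ᗮ := by
    intro n
    induction n with
    | zero => simpa using hy
    | succ n ih => rw [pow_succ']; exact map_mem_isometricPart_orthogonal T hT ih
  obtain ⟨z, -, φ, hφ, hz⟩ := tendsto_subseq_of_bounded (Metric.isBounded_closedBall (x := (0 : X))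
    (r := ‖y‖)) (x := fun n : ℕ => (T ^ n) y) (fun n => by
      simpa using hanti n.zero_le)
  have hnorm : ∀ k : ℕ, ‖(T ^ k) z‖ = L := by
    intro k
    refine tendsto_nhds_unique (((T ^ k).continuous.tendsto z).comp hz).norm ?_
    have : (fun n => ‖(⇑(T ^ k) ∘ (fun n : ℕ => (T ^ n) y) ∘ φ) n‖) =
        (fun n : ℕ => ‖(T ^ n) y‖) ∘ fun n => k + φ n := by
      funext n
      simp [Function.iterate_add_apply]
    rw [this]
    exact hlim.comp (Filter.tendsto_atTop_mono (fun n => Nat.le_add_left _ _) hφ.tendsto_atTop)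
  have hzK : z ∈ isometricPart T := by
    rw [mem_isometricPart T hT]
    intro n
    rw [hnorm n, ← hnorm 0, pow_zero, one_apply_eq_self]
  have hzK' : z ∈ (isometricPart T)ᗮ :=
    (Submodule.isClosed_orthogonal _).mem_of_tendsto hz (Filter.Eventually.of_forall fun n =>
      hmem (φ n))
  have hz0 : z = 0 := by
    have := Submodule.inner_right_of_mem_orthogonal hzK hzK'
    exact inner_self_eq_zero.1 this
  have hL : L = 0 := by rw [← hnorm 0, hz0]; simp
  rw [tendsto_zero_iff_norm_tendsto_zero, ← hL]
  exact hlim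

/-- The Neumann series of a contraction converges at the vectors orthogonal to its range. -/
theorem exists_tendsto_sum_pow_apply (T : X →L[ℂ] X) (hT : ∀ x, ‖T x‖ ≤ ‖x‖) {a : X}
    (ha : ∀ x, inner ℂ (T x) a = 0) :
    ∃ y, Filter.Tendsto (fun n : ℕ => ∑ k ∈ Finset.range n, (T ^ k) a) Filter.atTop (nhds y) := by
  have haK : a ∈ (isometricPart T)ᗮ := by
    rw [Submodule.mem_orthogonal]
    intro v hv
    obtain ⟨w, -, rfl⟩ := exists_map_eq_of_mem_isometricPart T hT hv
    exact ha w
  -- A fixed vector of `T` lies in the isometric part, so `1 - T` is injective, hence onto, on the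
  -- complement. Solving `y - T y = a` there makes the partial sums telescope.
  let f := (LinearMap.id - T.toLinearMap).restrict (p := (isometricPart T)ᗮ)
    (q := (isometricPart T)ᗮ)
    fun x hx => Submodule.sub_mem _ hx (map_mem_isometricPart_orthogonal T hT hx)
  have hf : Function.Injective f := by
    rw [← LinearMap.ker_eq_bot, LinearMap.ker_eq_bot']
    intro m hm
    have h1 : T m = m := (sub_eq_zero.1 (congrArg Subtype.val hm)).symm
    have h2 : (m : X) ∈ isometricPart T := by
      rw [mem_isometricPart T hT]
      intro n
      congr 1
      induction n with
      | zero => simp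
      | succ n ih => rw [pow_succ, mul_apply_eq_comp, h1, ih]
    exact Subtype.ext (inner_self_eq_zero.1 (Submodule.inner_right_of_mem_orthogonal h2 m.2))
  obtain ⟨y, hy⟩ := LinearMap.injective_iff_surjective.1 hf ⟨a, haK⟩
  have hya : (y : X) - T y = a := congrArg Subtype.val hy
  have hsum : ∀ n : ℕ, ∑ k ∈ Finset.range n, (T ^ k) a = y - (T ^ n) y := by
    intro n
    induction n with
    | zero => simp
    | succ n ih =>
      rw [Finset.sum_range_succ, ih, pow_succ, mul_apply_eq_comp, ← hya, map_sub]
      abel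
  refine ⟨y, ?_⟩
  simp_rw [hsum]
  simpa using (tendsto_pow_apply_of_mem_orthogonal T hT y.2).const_sub (y : X)

end Contraction

/-! ### Convergence of the walk and existence of the scattering matrix -/

theorem SimpleGraph.finite_dart {V : Type*} [Finite V] (G : SimpleGraph V) : Finite G.Dart :=
  Finite.of_injective _ SimpleGraph.Dart.toProd_injective

theorem norm_sq_add_norm_sq_of_mem_unitaryGroup {C : Matrix (Fin 2) (Fin 2) ℂ}
    (hC : C ∈ Matrix.unitaryGroup (Fin 2) ℂ) (p q : ℂ) :
    ‖C 0 0 * p + C 0 1 * q‖ ^ 2 + ‖C 1 0 * p + C 1 1 * q‖ ^ 2 = ‖p‖ ^ 2 + ‖q‖ ^ 2 := by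
  have h := Matrix.mem_unitaryGroup_iff'.1 hC
  have h00 := congrFun (congrFun h 0) 0
  have h01 := congrFun (congrFun h 0) 1
  have h10 := congrFun (congrFun h 1) 0
  have h11 := congrFun (congrFun h 1) 1
  simp [Matrix.mul_apply, Fin.sum_univ_two, Matrix.star_apply] at h00 h01 h10 h11
  have key : ((‖C 0 0 * p + C 0 1 * q‖ ^ 2 + ‖C 1 0 * p + C 1 1 * q‖ ^ 2 : ℝ) : ℂ) =
      ((‖p‖ ^ 2 + ‖q‖ ^ 2 : ℝ) : ℂ) := by
    push_cast
    simp only [← Complex.mul_conj', map_add, map_mul]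
    linear_combination p * (starRingEnd ℂ) p * h00 + q * (starRingEnd ℂ) p * h01 +
      p * (starRingEnd ℂ) q * h10 + q * (starRingEnd ℂ) q * h11
  exact_mod_cast key

namespace RotationSystem

variable {V : Type*} {G : SimpleGraph V} {B : Finset (CoverArc G)}

open Classical in
/-- The island-type arcs (labelled by their origins, blow-up vertices or tail roots), the bridges
(labelled by their origins) and the inward piers. -/
noncomputable def arcAt :
    (CoverArc G ⊕ B) ⊕ (CoverArc G ⊕ B) → TailedArc B
  | .inl (.inl e) => if h : e ∈ B then .quayIn ⟨e, h⟩ else .island e h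
  | .inl (.inr ξ) => .quayOut ξ
  | .inr (.inl e) => .bridge e
  | .inr (.inr ξ) => .tailIn ξ 0

open Classical in
/-- The label of the island-type arc ending at the origin of the given one. -/
noncomputable def prevIsland (R : RotationSystem G) : CoverArc G ⊕ B → CoverArc G ⊕ B
  | .inl e => if h : R.coverRot.symm e ∈ B then .inr ⟨R.coverRot.symm e, h⟩
      else .inl (R.coverRot.symm e)
  | .inr ξ => .inl ξ

/-- The label of the bridge or inward pier ending at a blow-up vertex or tail root. -/
def prevBridge (R : RotationSystem G) : CoverArc G ⊕ B → CoverArc G ⊕ B :=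
  Sum.map R.coverBar id

theorem prevIsland_injective (R : RotationSystem G) :
    Function.Injective (R.prevIsland (B := B)) := by
  rintro (e | ξ) (e' | ξ') h
  · simp only [prevIsland] at h
    split_ifs at h with h1 h2 h2
    · simpa using h
    · simpa using h
  · simp only [prevIsland] at h
    split_ifs at h with h1
    rw [Sum.inl.inj h] at h1
    exact absurd ξ'.2 h1
  · simp only [prevIsland] at h
    split_ifs at h with h1
    rw [← Sum.inl.inj h] at h1
    exact absurd ξ.2 h1
  · exact congrArg Sum.inr (Subtype.ext (Sum.inl.inj h))

theorem prevBridge_injective (R : RotationSystem G) :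
    Function.Injective (R.prevBridge (B := B)) :=
  R.coverBar.injective.sumMap Function.injective_id

theorem arcAt_prevIsland_inl (R : RotationSystem G) (e : CoverArc G) :
    arcAt (.inl (R.prevIsland (B := B) (.inl e))) = R.islandTo e := by
  by_cases h : R.coverRot.symm e ∈ B <;> simp [prevIsland, islandTo, arcAt, h]

/-- The walk on the arcs of `arcAt` without inflow. -/
noncomputable def interiorStep (R : RotationSystem G) (C : Matrix (Fin 2) (Fin 2) ℂ) :
    ((CoverArc G ⊕ B) ⊕ (CoverArc G ⊕ B) → ℂ) →ₗ[ℂ] ((CoverArc G ⊕ B) ⊕ (CoverArc G ⊕ B) → ℂ) where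
  toFun x
    | .inl w => C 0 0 * x (.inl (R.prevIsland w)) + C 0 1 * x (.inr (R.prevBridge w))
    | .inr (.inl e) => (-1) ^ (R.twist e.1).val *
        (C 1 0 * x (.inl (R.prevIsland (.inl e))) + C 1 1 * x (.inr (R.prevBridge (.inl e))))
    | .inr (.inr _) => 0
  map_add' x y := by
    funext i
    rcases i with w | e | ξ <;> simp <;> ring
  map_smul' c x := by
    funext i
    rcases i with w | e | ξ <;> simp <;> ring

/-- The inflow on the piers. -/
def inflow (α : B → ℂ) : (CoverArc G ⊕ B) ⊕ (CoverArc G ⊕ B) → ℂ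
  | .inr (.inr ξ) => α ξ
  | _ => 0

theorem iterate_evolve_tailIn (R : RotationSystem G) (C : Matrix (Fin 2) (Fin 2) ℂ) (α : B → ℂ)
    (t : ℕ) (ξ : B) (n : ℕ) : (R.evolve C)^[t] (initialState α) (.tailIn ξ n) = α ξ := by
  induction t generalizing n with
  | zero => rfl
  | succ t ih => rw [Function.iterate_succ_apply']; exact ih (n + 1)

/-- One step of the walk applies `interiorStep` and feeds the inflow in afresh at the piers; the
initial state is the inflow itself, whence `t + 1` terms. -/
theorem iterate_evolve_arcAt (R : RotationSystem G) (C : Matrix (Fin 2) (Fin 2) ℂ) (α : B → ℂ)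
    (t : ℕ) : (fun i => (R.evolve C)^[t] (initialState α) (arcAt i)) =
      ∑ k ∈ Finset.range (t + 1), (R.interiorStep C ^ k) (inflow α) := by
  induction t with
  | zero =>
    funext i
    rcases i with (e | ξ) | e | ξ
    · by_cases h : e ∈ B <;> simp [arcAt, h, initialState, inflow]
    all_goals simp [arcAt, initialState, inflow]
  | succ t ih =>
    rw [Finset.sum_range_succ', pow_zero, Module.End.one_apply]
    simp_rw [pow_succ', Module.End.mul_apply]
    rw [← map_sum, ← ih]
    funext i
    rw [Function.iterate_succ_apply']
    rcases i with (e | ξ) | e | ξ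
    · simp only [interiorStep, inflow, LinearMap.coe_mk, AddHom.coe_mk, Pi.add_apply,
        arcAt_prevIsland_inl, add_zero]
      by_cases h : e ∈ B <;> simp [arcAt, h, evolve, prevBridge, bridgeTo]
    · simp [interiorStep, inflow, arcAt, evolve, prevBridge, prevIsland]
    · simp only [interiorStep, inflow, LinearMap.coe_mk, AddHom.coe_mk, Pi.add_apply,
        arcAt_prevIsland_inl, add_zero]
      simp [arcAt, evolve, prevBridge, bridgeTo]
    · rw [← Function.iterate_succ_apply' (R.evolve C)]
      simp [interiorStep, inflow, arcAt, iterate_evolve_tailIn]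

/-- Each arc enters exactly one vertex, where the coin preserves the norm of its two inputs. The
only loss is the amplitude that escapes into a tail. -/
theorem sum_norm_sq_interiorStep_le [Fintype (CoverArc G)] (R : RotationSystem G)
    {C : Matrix (Fin 2) (Fin 2) ℂ} (hC : C ∈ Matrix.unitaryGroup (Fin 2) ℂ)
    (x : (CoverArc G ⊕ B) ⊕ (CoverArc G ⊕ B) → ℂ) :
    ∑ i, ‖R.interiorStep C x i‖ ^ 2 ≤ ∑ i, ‖x i‖ ^ 2 := by
  have hI : ∑ w, ‖x (.inl (R.prevIsland w))‖ ^ 2 = ∑ w, ‖x (.inl w)‖ ^ 2 :=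
    (Finite.injective_iff_bijective.1 R.prevIsland_injective).sum_comp fun w => ‖x (.inl w)‖ ^ 2
  have hB : ∑ w, ‖x (.inr (R.prevBridge w))‖ ^ 2 = ∑ w, ‖x (.inr w)‖ ^ 2 :=
    (Finite.injective_iff_bijective.1 R.prevBridge_injective).sum_comp fun w => ‖x (.inr w)‖ ^ 2
  rw [Fintype.sum_sum_type, Fintype.sum_sum_type (fun i => ‖x i‖ ^ 2), ← hI, ← hB,
    ← Finset.sum_add_distrib, ← Finset.sum_add_distrib]
  refine Finset.sum_le_sum fun w _ => ?_
  rw [← norm_sq_add_norm_sq_of_mem_unitaryGroup hC (x (.inl (R.prevIsland w)))]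
  refine add_le_add le_rfl ?_
  rcases w with e | ξ
  · simp [interiorStep]
  -- At a tail root the second output of the coin leaves the interior, and the pier slot receives
  -- zero.
  · refine le_of_eq_of_le ?_ (sq_nonneg _)
    simp [interiorStep]

theorem exists_tendsto_arcAt [Finite V] (R : RotationSystem G) {C : Matrix (Fin 2) (Fin 2) ℂ}
    (hC : C ∈ Matrix.unitaryGroup (Fin 2) ℂ) (α : B → ℂ) (i) :
    ∃ y, Filter.Tendsto (fun t : ℕ => (R.evolve C)^[t] (initialState α) (arcAt i)) Filter.atTop
      (nhds y) := by
  have := G.finite_dart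
  have : Fintype (CoverArc G) := Fintype.ofFinite _
  let e := WithLp.linearEquiv 2 ℂ ((CoverArc G ⊕ B) ⊕ (CoverArc G ⊕ B) → ℂ)
  let T := LinearMap.toContinuousLinearMap (e.symm.conj (R.interiorStep C))
  have hT : ∀ x, ‖T x‖ ≤ ‖x‖ := fun x => by
    rw [EuclideanSpace.norm_eq, EuclideanSpace.norm_eq]
    exact Real.sqrt_le_sqrt (R.sum_norm_sq_interiorStep_le hC (e x))
  have hrange : ∀ x, inner ℂ (T x) (e.symm (inflow α)) = 0 := fun x => by
    rw [PiLp.inner_apply]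
    refine Finset.sum_eq_zero fun i _ => ?_
    rcases i with w | a | ξ
    · exact inner_zero_right _
    · exact inner_zero_right _
    -- The inflow lives on the piers, where everything in the range of `T` vanishes.
    · exact inner_zero_left _
  obtain ⟨y, hy⟩ := exists_tendsto_sum_pow_apply T hT hrange
  refine ⟨y i, ?_⟩
  have hpow : ∀ k : ℕ, (T ^ k) (e.symm (inflow α)) =
      e.symm ((R.interiorStep C ^ k) (inflow α)) := by
    intro k
    induction k with
    | zero => simp
    | succ k ih =>
      rw [pow_succ', pow_succ', mul_apply_eq_comp, ih]
      rfl
  have h1 := ((PiLp.continuous_apply 2 _ i).tendsto y).comp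
    (hy.comp (Filter.tendsto_add_atTop_nat 1))
  refine h1.congr fun t => ?_
  have h2 := congrFun (iterate_evolve_arcAt R C α t) i
  rw [h2]
  simp only [Function.comp_apply, hpow]
  rw [← map_sum]
  rfl

theorem exists_tendsto_iterate_evolve [Finite V] (R : RotationSystem G)
    {C : Matrix (Fin 2) (Fin 2) ℂ} (hC : C ∈ Matrix.unitaryGroup (Fin 2) ℂ) (α : B → ℂ)
    (a : TailedArc B) :
    ∃ y, Filter.Tendsto (fun t : ℕ => (R.evolve C)^[t] (initialState α) a) Filter.atTop
      (nhds y) := by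
  have key := R.exists_tendsto_arcAt hC α
  cases a with
  | island e he => simpa [arcAt, he] using key (.inl (.inl e))
  | quayIn ξ => simpa [arcAt] using key (.inl (.inl ξ))
  | quayOut ξ => exact key (.inl (.inr ξ))
  | bridge e => exact key (.inr (.inl e))
  | tailIn ξ n => exact ⟨α ξ, by simp only [iterate_evolve_tailIn]; exact tendsto_const_nhds⟩
  | tailOut ξ n =>
    induction n with
    | zero =>
      -- The outward pier is not among the arcs of `arcAt`; it is a function of the quay and the
      -- inward pier one step earlier.
      obtain ⟨y, hy⟩ := key (.inl (.inl ξ))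
      refine ⟨C 1 0 * y + C 1 1 * α ξ, ?_⟩
      rw [← Filter.tendsto_add_atTop_iff_nat 1]
      simp only [Function.iterate_succ_apply', evolve, iterate_evolve_tailIn]
      have harc : arcAt (.inl (.inl ξ)) = TailedArc.quayIn ξ := dif_pos ξ.2
      rw [harc] at hy
      exact (hy.const_mul _).add tendsto_const_nhds
    | succ n ih =>
      obtain ⟨y, hy⟩ := ih
      refine ⟨y, ?_⟩
      rw [← Filter.tendsto_add_atTop_iff_nat 1]
      simpa only [Function.iterate_succ_apply', evolve] using hy

/-- The stationary state of the walk with inflow `α`. -/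
noncomputable def stationaryState (R : RotationSystem G) (C : Matrix (Fin 2) (Fin 2) ℂ)
    (α : B → ℂ) (a : TailedArc B) : ℂ :=
  Filter.atTop.limUnder fun t : ℕ => (R.evolve C)^[t] (initialState α) a

theorem tendsto_stationaryState [Finite V] (R : RotationSystem G) {C : Matrix (Fin 2) (Fin 2) ℂ}
    (hC : C ∈ Matrix.unitaryGroup (Fin 2) ℂ) (α : B → ℂ) (a : TailedArc B) :
    Filter.Tendsto (fun t : ℕ => (R.evolve C)^[t] (initialState α) a) Filter.atTop
      (nhds (R.stationaryState C α a)) :=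
  tendsto_nhds_limUnder (R.exists_tendsto_iterate_evolve hC α a)

theorem evolve_sum_smul (R : RotationSystem G) (C : Matrix (Fin 2) (Fin 2) ℂ) {ι : Type*}
    (s : Finset ι) (c : ι → ℂ) (Ψ : ι → TailedArc B → ℂ) :
    R.evolve C (∑ i ∈ s, c i • Ψ i) = ∑ i ∈ s, c i • R.evolve C (Ψ i) := by
  funext a
  simp only [Finset.sum_apply, Pi.smul_apply, smul_eq_mul]
  rcases a with _ | _ | _ | _ | _ | ⟨ξ, _ | n⟩ <;>
    simp only [evolve, Finset.sum_apply, Pi.smul_apply, smul_eq_mul, Finset.mul_sum,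
      ← Finset.sum_add_distrib] <;>
    exact Finset.sum_congr rfl fun i _ => by ring

theorem iterate_evolve_eq_sum (R : RotationSystem G) (C : Matrix (Fin 2) (Fin 2) ℂ)
    [DecidableEq B] (α : B → ℂ) (t : ℕ) :
    (R.evolve C)^[t] (initialState α) =
      ∑ η, α η • (R.evolve C)^[t] (initialState (Pi.single η 1)) := by
  induction t with
  | zero =>
    funext a
    rcases a with _ | _ | _ | _ | _ | _ <;>
      simp [initialState, Finset.sum_apply, Pi.single_apply]
  | succ t ih => simp only [Function.iterate_succ_apply', ih, evolve_sum_smul]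

/-- The inward pier carries `α` at all times, so the stationary inflow is `α` itself. -/
theorem isScatteringMatrix_iff [Finite V] (R : RotationSystem G) {C : Matrix (Fin 2) (Fin 2) ℂ}
    (hC : C ∈ Matrix.unitaryGroup (Fin 2) ℂ) {S : Matrix B B ℂ} :
    R.IsScatteringMatrix C S ↔
      ∀ α ξ, R.stationaryState C α (.tailOut ξ 0) = (S *ᵥ α) ξ := by
  have hin : ∀ (α : B → ℂ) (Ψ : TailedArc B → ℂ),
      (∀ a, Filter.Tendsto (fun t : ℕ => (R.evolve C)^[t] (initialState α) a) Filter.atTop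
        (nhds (Ψ a))) → (fun ξ => Ψ (.tailIn ξ 0)) = α := by
    intro α Ψ h
    funext ξ
    have := h (.tailIn ξ 0)
    simp only [iterate_evolve_tailIn] at this
    exact tendsto_nhds_unique this tendsto_const_nhds
  refine forall_congr' fun α => ⟨?_, fun h => ?_⟩
  · rintro ⟨Ψ, h1, h2⟩ ξ
    rw [hin α Ψ h1] at h2
    rw [← congrFun h2 ξ]
    exact tendsto_nhds_unique (R.tendsto_stationaryState hC α _) (h1 _)
  · refine ⟨R.stationaryState C α, R.tendsto_stationaryState hC α, ?_⟩
    rw [hin α _ (R.tendsto_stationaryState hC α)]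
    exact funext h

/-- By linearity the columns must be, and can be taken to be, the stationary outflows of the unit
inflows. -/
theorem existsUnique_isScatteringMatrix [Finite V] (R : RotationSystem G)
    {C : Matrix (Fin 2) (Fin 2) ℂ} (hC : C ∈ Matrix.unitaryGroup (Fin 2) ℂ) :
    ∃! S : Matrix B B ℂ, R.IsScatteringMatrix C S := by
  classical
  simp only [R.isScatteringMatrix_iff hC]
  refine ⟨.of fun ξ η => R.stationaryState C (Pi.single η 1) (.tailOut ξ 0), fun α ξ => ?_,
    fun S hS => ?_⟩
  · refine tendsto_nhds_unique (R.tendsto_stationaryState hC α _) ?_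
    simp only [iterate_evolve_eq_sum R C α, Matrix.mulVec, dotProduct, Finset.sum_apply,
      Pi.smul_apply, smul_eq_mul, Matrix.of_apply]
    refine tendsto_finsetSum _ fun η _ => ?_
    simpa only [mul_comm] using (R.tendsto_stationaryState hC (Pi.single η 1) _).const_mul (α η)
  · ext ξ η
    simp [hS]

end RotationSystem

/-! ### Signs and phases -/

/-- The sign `(-1)^k` of `k : ZMod 2`. -/
def zmodSign (k : ZMod 2) : ℂ := (-1) ^ k.val

theorem zmodSign_zero : zmodSign 0 = 1 := by simp [zmodSign]

theorem zmodSign_one : zmodSign 1 = -1 := by simp [zmodSign, ZMod.val_one]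

theorem zmodTwo_cases (k : ZMod 2) : k = 0 ∨ k = 1 := by
  revert k
  decide

theorem zmodSign_add (j k : ZMod 2) : zmodSign (j + k) = zmodSign j * zmodSign k := by
  have h : (1 : ZMod 2) + 1 = 0 := by decide
  rcases zmodTwo_cases j with rfl | rfl <;> rcases zmodTwo_cases k with rfl | rfl <;>
    simp [zmodSign_zero, zmodSign_one, h]

theorem zmodSign_mul_self (k : ZMod 2) : zmodSign k * zmodSign k = 1 := by
  rw [← zmodSign_add, CharTwo.add_self_eq_zero, zmodSign_zero]

theorem star_zmodSign (k : ZMod 2) : star (zmodSign k) = zmodSign k := by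
  simp [zmodSign]

theorem exp_mul_ite_pi (k : ZMod 2) :
    Complex.exp (Complex.I * ((if k = 1 then Real.pi else 0 : ℝ) : ℂ)) = zmodSign k := by
  rcases zmodTwo_cases k with rfl | rfl
  · simp [zmodSign_zero]
  · simp [zmodSign_one, mul_comm Complex.I, Complex.exp_pi_mul_I]

theorem exp_neg_ite_pi_sub_ite_pi (j k : ZMod 2) :
    Complex.exp (-(Complex.I * (((if k = 1 then Real.pi else 0) -
      (if j = 1 then Real.pi else 0) : ℝ) : ℂ))) = zmodSign j * zmodSign k := by
  rw [Complex.ofReal_sub, mul_sub, neg_sub, Complex.exp_sub, exp_mul_ite_pi, exp_mul_ite_pi,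
    div_eq_iff (left_ne_zero_of_mul_eq_one (zmodSign_mul_self k)), mul_assoc, zmodSign_mul_self,
    mul_one]

/-! ### Effect of switches on the double cover -/

namespace RotationSystem

variable {V : Type*} {G : SimpleGraph V}

theorem rho_apply (R : RotationSystem G) (e : G.Dart) : R.rho e = (R.rot e.snd ⟨e, rfl⟩).1 := rfl

theorem rho_inv_apply (R : RotationSystem G) (e : G.Dart) :
    R.rho⁻¹ e = ((R.rot e.snd)⁻¹ ⟨e, rfl⟩).1 := rfl

theorem rho_apply_snd (R : RotationSystem G) (e : G.Dart) : (R.rho e).snd = e.snd :=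
  (R.rot e.snd ⟨e, rfl⟩).2

theorem rho_inv_apply_snd (R : RotationSystem G) (e : G.Dart) : (R.rho⁻¹ e).snd = e.snd :=
  ((R.rot e.snd)⁻¹ ⟨e, rfl⟩).2

theorem coverRot_apply (R : RotationSystem G) (e : CoverArc G) :
    R.coverRot e = ((if e.2 = 0 then R.rho else R.rho⁻¹) e.1, e.2) := rfl

theorem coverRot_apply_snd (R : RotationSystem G) (e : CoverArc G) :
    (R.coverRot e).1.snd = e.1.snd := by
  rw [coverRot_apply]
  split_ifs
  · exact R.rho_apply_snd _
  · exact R.rho_inv_apply_snd _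

section Switching

variable [DecidableEq V]

theorem switch_rho_apply (R : RotationSystem G) (x : V) (e : G.Dart) :
    (R.switch x).rho e = if e.snd = x then R.rho⁻¹ e else R.rho e := by
  rw [rho_apply, rho_apply, rho_inv_apply]
  split_ifs with h
  · subst h
    simp [switch]
  · simp [switch, Function.update_of_ne h]

theorem switch_rho_inv_apply (R : RotationSystem G) (x : V) (e : G.Dart) :
    (R.switch x).rho⁻¹ e = if e.snd = x then R.rho e else R.rho⁻¹ e := by
  rw [rho_inv_apply, rho_apply, rho_inv_apply]
  split_ifs with h
  · subst h
    simp [switch]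
  · simp [switch, Function.update_of_ne h]

theorem sheetShift_apply (l : List V) (e : CoverArc G) :
    sheetShift G l e = (e.1, e.2 + (l.count e.1.snd : ZMod 2)) := rfl

theorem sheetShift_cons (x : V) (l : List V) (e : CoverArc G) :
    sheetShift G (x :: l) e = sheetShift G l (sheetShift G [x] e) := by
  simp only [sheetShift_apply, List.count_cons, List.count_nil]
  refine Prod.ext rfl ?_
  push_cast
  ring

/-- At the switched vertex, exchanging the sheets swaps `ρ` with `ρ⁻¹`, which undoes the reversal of
the rotation. -/
theorem coverRot_switch_sheetShift (R : RotationSystem G) (x : V) (e : CoverArc G) :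
    (R.switch x).coverRot (sheetShift G [x] e) = sheetShift G [x] (R.coverRot e) := by
  have h2 : (1 : ZMod 2) + 1 = 0 := by decide
  refine Prod.ext ?_ ?_
  · obtain ⟨e, k⟩ := e
    simp only [coverRot_apply, sheetShift_apply]
    by_cases h : e.snd = x
    · rcases zmodTwo_cases k with rfl | rfl <;>
        simp [h, h2, switch_rho_apply, switch_rho_inv_apply,
          -Equiv.Perm.coe_inv]
    · rcases zmodTwo_cases k with rfl | rfl <;>
        simp [h, Ne.symm h, switch_rho_apply, switch_rho_inv_apply,
          -Equiv.Perm.coe_inv]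
  · simp only [sheetShift_apply, coverRot_apply_snd]
    rfl

theorem EquivalentVia.coverRot_sheetShift {R₁ R₂ : RotationSystem G} {l : List V}
    (h : R₁.EquivalentVia l R₂) (e : CoverArc G) :
    R₂.coverRot (sheetShift G l e) = sheetShift G l (R₁.coverRot e) := by
  unfold EquivalentVia at h
  induction l generalizing R₁ e with
  | nil => subst h; simp [sheetShift_apply]
  | cons x l ih =>
    rw [sheetShift_cons x l e, ih h, coverRot_switch_sheetShift, ← sheetShift_cons]

theorem EquivalentVia.twist_eq {R₁ R₂ : RotationSystem G} {l : List V}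
    (h : R₁.EquivalentVia l R₂) (e : G.Dart) :
    R₂.twist e = R₁.twist e + (l.count e.fst : ZMod 2) + (l.count e.snd : ZMod 2) := by
  unfold EquivalentVia at h
  induction l generalizing R₁ with
  | nil => subst h; simp
  | cons x l ih =>
    -- Without loops, a switch meets at most one end of an edge, so the two counts together record
    -- each twist change once.
    have hne : e.fst ≠ e.snd := e.adj.ne
    rw [ih h]
    simp only [switch, List.count_cons, beq_iff_eq]
    by_cases h1 : e.fst = x
    · have h2 : x ≠ e.snd := h1 ▸ hne
      simp [h1, h2]
      ring
    · by_cases h2 : e.snd = x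
      · simp [h2, Ne.symm h1, h1]
        ring
      · simp [h1, h2, Ne.symm h1, Ne.symm h2]

theorem EquivalentVia.coverBar_sheetShift {R₁ R₂ : RotationSystem G} {l : List V}
    (h : R₁.EquivalentVia l R₂) (e : CoverArc G) :
    R₂.coverBar (sheetShift G l e) = sheetShift G l (R₁.coverBar e) := by
  refine Prod.ext rfl ?_
  change e.2 + (l.count e.1.snd : ZMod 2) + R₂.twist e.1 =
    e.2 + R₁.twist e.1 + (l.count e.1.fst : ZMod 2)
  rw [h.twist_eq]
  linear_combination CharTwo.add_self_eq_zero (l.count e.1.snd : ZMod 2)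

end Switching

variable {B : Finset (CoverArc G)}

/-! ### Paths and existence of gauge phases -/

section Paths

variable (R : RotationSystem G)

theorem IsPath.append {R : RotationSystem G} {u v w : TailedVertex B} {p q : List (TailedArc B)}
    (hp : R.IsPath u p v) (hq : R.IsPath v q w) : R.IsPath u (p ++ q) w := by
  induction p generalizing u with
  | nil => obtain rfl : u = v := hp; exact hq
  | cons a p ih => exact ⟨hp.1, ih hp.2⟩

theorem isPath_singleton (a : TailedArc B) : R.IsPath (R.origin a) [a] (R.terminus a) :=
  ⟨rfl, rfl⟩

/-- The vertex `v` can be reached from `u` along a path. -/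
def Reachable (u v : TailedVertex B) : Prop := ∃ p, R.IsPath u p v

theorem Reachable.trans {R : RotationSystem G} {u v w : TailedVertex B} (h : R.Reachable u v)
    (h' : R.Reachable v w) : R.Reachable u w :=
  ⟨_, h.choose_spec.append h'.choose_spec⟩

theorem reachable_refl (u : TailedVertex B) : R.Reachable u u := ⟨[], rfl⟩

theorem reachable_terminus (a : TailedArc B) : R.Reachable (R.origin a) (R.terminus a) :=
  ⟨_, R.isPath_singleton a⟩

theorem reachable_coverRot (e : CoverArc G) :
    R.Reachable (B := B) (.inner e) (.inner (R.coverRot e)) := by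
  by_cases h : e ∈ B
  · exact (R.reachable_terminus (.quayIn ⟨e, h⟩)).trans (R.reachable_terminus (.quayOut ⟨e, h⟩))
  · exact R.reachable_terminus (.island e h)

/-- Island arcs are directed, but `coverRot` has finite order, so going on around the island leads
back. -/
theorem reachable_of_coverRot [Finite V] (e : CoverArc G) :
    R.Reachable (B := B) (.inner (R.coverRot e)) (.inner e) := by
  have := G.finite_dart
  have key : ∀ n : ℕ, R.Reachable (B := B) (.inner (R.coverRot e))
      (.inner ((R.coverRot ^ n) (R.coverRot e))) := by
    intro n
    induction n with
    | zero => exact R.reachable_refl _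
    | succ n ih => rw [pow_succ']; exact ih.trans (R.reachable_coverRot _)
  have h := key (orderOf R.coverRot - 1)
  rwa [← Equiv.Perm.mul_apply, ← pow_succ, Nat.sub_add_cancel (orderOf_pos R.coverRot),
    pow_orderOf_eq_one] at h

theorem reachable_origin [Finite V] (a : TailedArc B) :
    R.Reachable (R.terminus a) (R.origin a) := by
  cases a with
  | island e he => exact R.reachable_of_coverRot e
  | quayIn ξ => exact (R.reachable_terminus (.quayOut ξ)).trans (R.reachable_of_coverRot ξ)
  | quayOut ξ => exact (R.reachable_of_coverRot ξ).trans (R.reachable_terminus (.quayIn ξ))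
  | bridge e =>
    have h := R.reachable_terminus (B := B) (.bridge (R.coverBar e))
    have hbar : R.coverBar (R.coverBar e) = e := R.coverBar.left_inv e
    simpa only [origin, terminus, hbar] using h
  | tailIn ξ n => exact R.reachable_terminus (.tailOut ξ n)
  | tailOut ξ n => exact R.reachable_terminus (.tailIn ξ n)

theorem Reachable.symm [Finite V] {R : RotationSystem G} {u v : TailedVertex B}
    (h : R.Reachable u v) : R.Reachable v u := by
  obtain ⟨p, hp⟩ := h
  induction p generalizing u with
  | nil => obtain rfl : u = v := hp; exact R.reachable_refl _
  | cons a p ih => exact (ih hp.2).trans (hp.1 ▸ R.reachable_origin a)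

theorem exists_isGaugePhase [Finite V] (R₁ R₂ : RotationSystem G) :
    ∃ Δ : TailedVertex B → ℝ, R₁.IsGaugePhase R₂ Δ := by
  let r : Setoid (TailedVertex B) :=
    ⟨R₁.Reachable, R₁.reachable_refl, Reachable.symm, Reachable.trans⟩
  let base : TailedVertex B → TailedVertex B := fun v => (Quotient.mk r v).out
  have hbase : ∀ v, R₁.Reachable (base v) v := fun v => Quotient.exact (s := r) (Quotient.out_eq (Quotient.mk r v))
  choose p hp using hbase
  exact ⟨fun v => pathIntegral (fun a => R₂.theta a - R₁.theta a) (p v), base,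
    fun u q v hq => congrArg Quotient.out (Quotient.sound (s := r) ⟨q, hq⟩),
    fun v => ⟨p v, hp v, rfl⟩⟩

end Paths

/-- The faces merely partition the index set, and the bridge into a blow-up vertex ends there
because `coverBar` is an involution. -/
theorem gaugeMatrix_eq_diagonal [DecidableEq B] (R : RotationSystem G) (Δ : TailedVertex B → ℝ) :
    R.gaugeMatrix Δ =
      Matrix.diagonal fun ξ : B => Complex.exp (-(Complex.I * (Δ (.inner ξ) : ℂ))) := by
  have hbar : ∀ e, R.coverBar (R.coverBar e) = e := R.coverBar.left_inv
  unfold gaugeMatrix gaugeBlock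
  classical
  have key := Matrix.blockDiagonal'_diagonal fun (f : R.Face) (ξ : {ξ : B // R.faceOf ξ = f}) =>
    Complex.exp (-(Complex.I * (Δ (R.terminus (R.bridgeTo (ξ : B))) : ℂ)))
  refine (congrArg _ (Eq.trans ?_ key)).trans ?_
  · congr!
  · rw [Matrix.reindex_apply, Matrix.submatrix_diagonal_equiv]
    ext ξ η
    simp only [Matrix.diagonal_apply, Function.comp_apply, terminus, bridgeTo, hbar]
    rfl

/-! ### The gauge phase as a coboundary of signs -/

section Gauge

variable [DecidableEq V]

/-- The number mod `2` of switches at the vertex of `G` below a vertex of the blow-up graph with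
tails. -/
def switchParity (l : List V) : TailedVertex B → ZMod 2
  | .inner e => l.count e.1.snd
  | .tail ξ _ => l.count ξ.1.1.snd

variable {R₁ R₂ : RotationSystem G} {l : List V}

theorem EquivalentVia.exp_theta_sub_theta (h : R₁.EquivalentVia l R₂) (a : TailedArc B) :
    Complex.exp (-(Complex.I * ((R₂.theta a - R₁.theta a : ℝ) : ℂ))) =
      zmodSign (switchParity l (R₁.origin a)) * zmodSign (switchParity l (R₁.terminus a)) := by
  cases a with
  | bridge e =>
    refine (exp_neg_ite_pi_sub_ite_pi (R₁.twist e.1) (R₂.twist e.1)).trans ?_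
    rw [h.twist_eq, zmodSign_add, zmodSign_add, ← mul_assoc, ← mul_assoc, zmodSign_mul_self,
      one_mul, mul_comm]
    rfl
  | _ => simp [theta, origin, terminus, switchParity, coverRot_apply_snd, zmodSign_mul_self]

/-- The sign of every intermediate vertex occurs twice and cancels, so only the endpoints of the
path matter. -/
theorem EquivalentVia.exp_pathIntegral (h : R₁.EquivalentVia l R₂) {u v : TailedVertex B}
    {p : List (TailedArc B)} (hp : R₁.IsPath u p v) :
    Complex.exp (-(Complex.I * (pathIntegral (fun a => R₂.theta a - R₁.theta a) p : ℂ))) =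
      zmodSign (switchParity l u) * zmodSign (switchParity l v) := by
  induction p generalizing u with
  | nil =>
    obtain rfl : u = v := hp
    simp [pathIntegral, zmodSign_mul_self]
  | cons a p ih =>
    have h1 := h.exp_theta_sub_theta a
    have h2 := ih hp.2
    rw [hp.1] at h1
    have h3 := zmodSign_mul_self (switchParity l (R₁.terminus a))
    simp only [pathIntegral, List.map_cons, List.sum_cons, Complex.ofReal_add] at h2 ⊢
    rw [mul_add, neg_add, Complex.exp_add, h2, h1]
    linear_combination zmodSign (switchParity l u) * zmodSign (switchParity l v) * h3

theorem EquivalentVia.exp_gaugePhase (h : R₁.EquivalentVia l R₂) {Δ : TailedVertex B → ℝ}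
    (hΔ : R₁.IsGaugePhase R₂ Δ) :
    ∃ κ : TailedVertex B → ZMod 2,
      (∀ v, Complex.exp (-(Complex.I * (Δ v : ℂ))) = zmodSign (κ v)) ∧
      ∀ a, κ (R₁.terminus a) + switchParity l (R₁.terminus a) =
        κ (R₁.origin a) + switchParity l (R₁.origin a) := by
  obtain ⟨base, hbase, hp⟩ := hΔ
  -- Adding `switchParity l v` leaves the parity at the base vertex, which is constant along arcs.
  refine ⟨fun v => switchParity l (base v) + switchParity l v, fun v => ?_, fun a => ?_⟩
  · obtain ⟨p, hp, hv⟩ := hp v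
    rw [hv, h.exp_pathIntegral hp, zmodSign_add]
  · simp [hbase _ _ _ (R₁.isPath_singleton a), add_assoc, CharTwo.add_self_eq_zero]

end Gauge

end RotationSystem

/-! ### Intertwining of the two walks -/

namespace RotationSystem

variable {V : Type*} {G : SimpleGraph V} {B₁ B₂ : Finset (CoverArc G)}

theorem terminus_islandTo (R : RotationSystem G) (e : CoverArc G) :
    R.terminus (R.islandTo (B := B₁) e) = .inner e := by
  by_cases h : R.coverRot.symm e ∈ B₁ <;> simp [islandTo, h, terminus]

theorem terminus_bridgeTo (R : RotationSystem G) (e : CoverArc G) :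
    R.terminus (R.bridgeTo (B := B₁) e) = .inner e :=
  congrArg TailedVertex.inner (R.coverBar.left_inv e)

variable [DecidableEq V]

/-- The map induced by `sheetShift` on the arcs of the blow-up graphs with tails. -/
def shiftArc (l : List V) (hB : ∀ ξ, ξ ∈ B₁ ↔ sheetShift G l ξ ∈ B₂) :
    TailedArc B₁ → TailedArc B₂
  | .island e he => .island (sheetShift G l e) (he ∘ (hB e).2)
  | .quayIn ξ => .quayIn ((sheetShift G l).subtypeEquiv hB ξ)
  | .quayOut ξ => .quayOut ((sheetShift G l).subtypeEquiv hB ξ)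
  | .bridge e => .bridge (sheetShift G l e)
  | .tailIn ξ n => .tailIn ((sheetShift G l).subtypeEquiv hB ξ) n
  | .tailOut ξ n => .tailOut ((sheetShift G l).subtypeEquiv hB ξ) n

variable {R₁ R₂ : RotationSystem G} {l : List V}

theorem EquivalentVia.islandTo_sheetShift (h : R₁.EquivalentVia l R₂)
    (hB : ∀ ξ, ξ ∈ B₁ ↔ sheetShift G l ξ ∈ B₂) (e : CoverArc G) :
    R₂.islandTo (sheetShift G l e) = shiftArc l hB (R₁.islandTo e) := by
  have hs : R₂.coverRot.symm (sheetShift G l e) = sheetShift G l (R₁.coverRot.symm e) := by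
    rw [Equiv.symm_apply_eq, h.coverRot_sheetShift, Equiv.apply_symm_apply]
  unfold islandTo
  by_cases hm : R₁.coverRot.symm e ∈ B₁
  · have hm' := (hB _).1 hm
    simp only [hs, hm, hm', dif_pos]
    rfl
  · have hm' : sheetShift G l (R₁.coverRot.symm e) ∉ B₂ := fun h => hm ((hB _).2 h)
    simp only [hs, hm, hm', dif_neg, not_false_eq_true]
    rfl

theorem EquivalentVia.bridgeTo_sheetShift (h : R₁.EquivalentVia l R₂)
    (hB : ∀ ξ, ξ ∈ B₁ ↔ sheetShift G l ξ ∈ B₂) (e : CoverArc G) :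
    R₂.bridgeTo (sheetShift G l e) = shiftArc l hB (R₁.bridgeTo e) :=
  congrArg TailedArc.bridge (h.coverBar_sheetShift e)

variable {κ : TailedVertex B₁ → ZMod 2}

/-- The gauge transformation intertwines the two time evolutions. -/
theorem EquivalentVia.evolve_shiftArc (h : R₁.EquivalentVia l R₂)
    (hB : ∀ ξ, ξ ∈ B₁ ↔ sheetShift G l ξ ∈ B₂)
    (hκ : ∀ a, κ (R₁.terminus a) + switchParity l (R₁.terminus a) =
      κ (R₁.origin a) + switchParity l (R₁.origin a))
    (C : Matrix (Fin 2) (Fin 2) ℂ) {Ψ₁ : TailedArc B₁ → ℂ} {Ψ₂ : TailedArc B₂ → ℂ}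
    (hΨ : ∀ a, Ψ₂ (shiftArc l hB a) = zmodSign (κ (R₁.terminus a)) * Ψ₁ a) (a : TailedArc B₁) :
    R₂.evolve C Ψ₂ (shiftArc l hB a) = zmodSign (κ (R₁.terminus a)) * R₁.evolve C Ψ₁ a := by
  have hI : ∀ e, Ψ₂ (R₂.islandTo (sheetShift G l e)) =
      zmodSign (κ (.inner e)) * Ψ₁ (R₁.islandTo e) := fun e => by
    rw [h.islandTo_sheetShift hB, hΨ, terminus_islandTo]
  have hb : ∀ e, Ψ₂ (R₂.bridgeTo (sheetShift G l e)) =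
      zmodSign (κ (.inner e)) * Ψ₁ (R₁.bridgeTo e) := fun e => by
    rw [h.bridgeTo_sheetShift hB, hΨ, terminus_bridgeTo]
  have hq : ∀ ξ : B₁, κ (.tail ξ 0) = κ (.inner ξ) := fun ξ =>
    add_right_cancel (hκ (.quayIn ξ))
  have ht : ∀ (ξ : B₁) n, κ (.tail ξ (n + 1)) = κ (.tail ξ n) := fun ξ n =>
    add_right_cancel (hκ (.tailOut ξ n))
  have hrot : ∀ e, switchParity (B := B₁) l (.inner (R₁.coverRot e)) =
      switchParity (B := B₁) l (.inner e) := fun e => by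
    simp only [switchParity, coverRot_apply_snd]
  cases a with
  | island e he =>
    have h1 : κ (.inner (R₁.coverRot e)) = κ (.inner e) := by
      have := hκ (.island e he)
      simp only [terminus, origin, hrot] at this
      exact add_right_cancel this
    simp only [evolve, shiftArc, terminus, hI, hb, h1]
    ring
  | quayIn ξ =>
    simp only [evolve, shiftArc, terminus, Equiv.subtypeEquiv_apply, hI, hb, hq]
    ring
  | quayOut ξ =>
    have h1 : κ (.inner (R₁.coverRot ξ)) = κ (.tail ξ 0) := by
      have := hκ (.quayOut ξ)
      simp only [terminus, origin, hrot] at this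
      exact add_right_cancel this
    have h2 := hΨ (.quayIn ξ)
    have h3 := hΨ (.tailIn ξ 0)
    simp only [shiftArc, terminus] at h2 h3
    simp only [evolve, shiftArc, terminus, h1, h2, h3]
    ring
  | bridge e =>
    -- The jump of `κ` across the bridge equals the change of twist, both being the sum of the
    -- parities at its ends.
    have h1 : zmodSign (R₂.twist e.1) * zmodSign (κ (.inner e)) =
        zmodSign (κ (.inner (R₁.coverBar e))) * zmodSign (R₁.twist e.1) := by
      rw [← zmodSign_add, ← zmodSign_add, h.twist_eq]
      congr 1
      have h2 : κ (.inner (R₁.coverBar e)) + (l.count e.1.fst : ZMod 2) =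
        κ (.inner e) + (l.count e.1.snd : ZMod 2) := hκ (.bridge e)
      linear_combination h2.symm +
        CharTwo.add_self_eq_zero (l.count e.1.fst : ZMod 2)
    change zmodSign (R₂.twist e.1) * (C 1 0 * Ψ₂ (R₂.islandTo (sheetShift G l e)) +
      C 1 1 * Ψ₂ (R₂.bridgeTo (sheetShift G l e))) = zmodSign (κ (.inner (R₁.coverBar e))) *
        (zmodSign (R₁.twist e.1) * (C 1 0 * Ψ₁ (R₁.islandTo e) + C 1 1 * Ψ₁ (R₁.bridgeTo e)))
    rw [hI, hb]
    linear_combination (C 1 0 * Ψ₁ (R₁.islandTo e) + C 1 1 * Ψ₁ (R₁.bridgeTo e)) * h1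
  | tailIn ξ n =>
    have h2 := hΨ (.tailIn ξ (n + 1))
    simp only [shiftArc, terminus] at h2
    simp only [evolve, shiftArc, terminus, h2, ht]
  | tailOut ξ n =>
    cases n with
    | zero =>
      have h2 := hΨ (.quayIn ξ)
      have h3 := hΨ (.tailIn ξ 0)
      simp only [shiftArc, terminus] at h2 h3
      simp only [evolve, shiftArc, terminus, h2, h3, ht]
      ring
    | succ n =>
      have h2 := hΨ (.tailOut ξ n)
      simp only [shiftArc, terminus] at h2
      simp only [evolve, shiftArc, terminus, h2, ht]

theorem EquivalentVia.iterate_evolve_shiftArc (h : R₁.EquivalentVia l R₂)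
    (hB : ∀ ξ, ξ ∈ B₁ ↔ sheetShift G l ξ ∈ B₂)
    (hκ : ∀ a, κ (R₁.terminus a) + switchParity l (R₁.terminus a) =
      κ (R₁.origin a) + switchParity l (R₁.origin a))
    (C : Matrix (Fin 2) (Fin 2) ℂ) (α : B₂ → ℂ) (t : ℕ) (a : TailedArc B₁) :
    (R₂.evolve C)^[t] (initialState α) (shiftArc l hB a) = zmodSign (κ (R₁.terminus a)) *
      (R₁.evolve C)^[t] (initialState fun ξ =>
        zmodSign (κ (.inner ξ)) * α ((sheetShift G l).subtypeEquiv hB ξ)) a := by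
  induction t generalizing a with
  | zero =>
    cases a with
    | tailIn ξ n =>
      have h1 : κ (.tail ξ n) = κ (.inner ξ) := by
        induction n with
        | zero => exact add_right_cancel (hκ (.quayIn ξ))
        | succ n ih => rw [← ih]; exact add_right_cancel (hκ (.tailOut ξ n))
      simp only [Function.iterate_zero, id, shiftArc, initialState, terminus, h1, ← mul_assoc,
        zmodSign_mul_self, one_mul]
    | _ => simp [shiftArc, initialState]
  | succ t ih =>
    simp only [Function.iterate_succ_apply']
    exact h.evolve_shiftArc hB hκ C ih a

theorem EquivalentVia.scatteringMatrix_apply [Finite V] (h : R₁.EquivalentVia l R₂)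
    (hB : ∀ ξ, ξ ∈ B₁ ↔ sheetShift G l ξ ∈ B₂)
    (hκ : ∀ a, κ (R₁.terminus a) + switchParity l (R₁.terminus a) =
      κ (R₁.origin a) + switchParity l (R₁.origin a))
    {C : Matrix (Fin 2) (Fin 2) ℂ} (hC : C ∈ Matrix.unitaryGroup (Fin 2) ℂ)
    {S₁ : Matrix B₁ B₁ ℂ} {S₂ : Matrix B₂ B₂ ℂ} (hS₁ : R₁.IsScatteringMatrix C S₁)
    (hS₂ : R₂.IsScatteringMatrix C S₂) (ξ η : B₁) :
    S₂ ((sheetShift G l).subtypeEquiv hB ξ) ((sheetShift G l).subtypeEquiv hB η) =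
      zmodSign (κ (.inner ξ)) * S₁ ξ η * zmodSign (κ (.inner η)) := by
  classical
  rw [isScatteringMatrix_iff _ hC] at hS₁ hS₂
  -- Undoing the gauge on a unit inflow in the second system gives a signed unit inflow in the
  -- first.
  have hα : (fun ζ : B₁ => zmodSign (κ (.inner ζ)) *
      (Pi.single ((sheetShift G l).subtypeEquiv hB η) 1 : B₂ → ℂ)
        ((sheetShift G l).subtypeEquiv hB ζ)) =
      zmodSign (κ (.inner η)) • Pi.single η 1 := by
    funext ζ
    by_cases hζ : ζ = η
    · subst hζ; simp
    · rw [Pi.single_eq_of_ne (((sheetShift G l).subtypeEquiv hB).injective.ne hζ)]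
      simp [hζ]
  have h1 := R₂.tendsto_stationaryState hC
    (Pi.single ((sheetShift G l).subtypeEquiv hB η) 1) (shiftArc l hB (.tailOut ξ 0))
  simp only [h.iterate_evolve_shiftArc hB hκ, hα] at h1
  have h2 := tendsto_nhds_unique h1 ((R₁.tendsto_stationaryState hC _ _).const_mul _)
  -- The outward pier ends at tail vertex `1`, where its sign is read off; `κ` is constant from
  -- there back to the origin of the boundary arc.
  have hout : κ (.tail ξ 1) = κ (.inner ξ) :=
    (add_right_cancel (hκ (.tailOut ξ 0))).trans (add_right_cancel (hκ (.quayIn ξ)))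
  simp only [shiftArc, terminus, hS₁, hS₂, Matrix.mulVec_smul, Matrix.mulVec_single_one,
    Pi.smul_apply, smul_eq_mul, zero_add, hout] at h2
  rw [mul_assoc, mul_comm (S₁ ξ η)]
  exact h2

end RotationSystem

theorem proposition6 {V : Type*} [Finite V] [DecidableEq V] (G : SimpleGraph V)
    (C : Matrix (Fin 2) (Fin 2) ℂ) (hC : C ∈ Matrix.unitaryGroup (Fin 2) ℂ)
    (R₁ R₂ : RotationSystem G) (l : List V) (hR : R₁.EquivalentVia l R₂)
    (B₁ B₂ : Finset (CoverArc G)) (hB : ∀ ξ, ξ ∈ B₁ ↔ sheetShift G l ξ ∈ B₂) :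
    (∃! S₁ : Matrix B₁ B₁ ℂ, R₁.IsScatteringMatrix C S₁) ∧
    (∃! S₂ : Matrix B₂ B₂ ℂ, R₂.IsScatteringMatrix C S₂) ∧
    (∃ Δ : TailedVertex B₁ → ℝ, R₁.IsGaugePhase R₂ Δ) ∧
    ∀ Δ : TailedVertex B₁ → ℝ, R₁.IsGaugePhase R₂ Δ →
      R₁.gaugeMatrix Δ ∈ Matrix.unitaryGroup B₁ ℂ ∧
      ∀ (S₁ : Matrix B₁ B₁ ℂ) (S₂ : Matrix B₂ B₂ ℂ),
        R₁.IsScatteringMatrix C S₁ → R₂.IsScatteringMatrix C S₂ →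
        S₂.submatrix ((sheetShift G l).subtypeEquiv hB) ((sheetShift G l).subtypeEquiv hB) =
          (R₁.gaugeMatrix Δ)ᴴ * S₁ * R₁.gaugeMatrix Δ := by
  refine ⟨R₁.existsUnique_isScatteringMatrix hC, R₂.existsUnique_isScatteringMatrix hC,
    RotationSystem.exists_isGaugePhase R₁ R₂, fun Δ hΔ => ?_⟩
  obtain ⟨κ, hΔκ, hκ⟩ := hR.exp_gaugePhase hΔ
  rw [RotationSystem.gaugeMatrix_eq_diagonal]
  simp only [hΔκ]
  -- The entries are real signs, so the gauge matrix is its own adjoint and its own inverse.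
  have hstar : (Matrix.diagonal fun ξ : B₁ => zmodSign (κ (.inner ξ)))ᴴ =
      Matrix.diagonal fun ξ : B₁ => zmodSign (κ (.inner ξ)) := by
    rw [Matrix.diagonal_conjTranspose]
    exact congrArg Matrix.diagonal (funext fun ξ => star_zmodSign _)
  refine ⟨?_, fun S₁ S₂ hS₁ hS₂ => ?_⟩
  · rw [Matrix.mem_unitaryGroup_iff, Matrix.star_eq_conjTranspose, hstar,
      Matrix.diagonal_mul_diagonal]
    simp only [zmodSign_mul_self, Matrix.diagonal_one]
  · ext ξ η
    rw [hstar, Matrix.mul_diagonal, Matrix.diagonal_mul]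
    exact hR.scatteringMatrix_apply hB hκ hC hS₁ hS₂ ξ η
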